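/- Let $(M,D)$ be a locally flat manifold, i.e. a smooth $n$-dimensional manifold $M$ (connected, Hausdorff, second countable) with a smooth torsion-free linear connection $D$ on $TM$ of zero curvature. Let $\mathcal A=\mathcal X(M)$ be the space of smooth vector fields with the product $ab=D_ab$, and let $W=C^\infty(M,\mathbb R)$ be the left $\mathcal A$-module with $aw=\langle dw,a\rangle$ (and zero right action). For $q\ge 1$ let $C_q(\mathcal A,W)$ be the space of all $\mathbb R$-multilinear maps $\mathcal A^q\to W$, on which $\mathcal A$ acts by $$(af)(a_1,\dots,a_q)=a\bigl(f(a_1,\dots,a_q)\bigr)-\sum_{j=1}^q f(a_1,\dots,aa_j,\dots,a_q),$$ and let $\delta:C_q(\mathcal A,W)\to C_{q+1}(\mathcal A,W)$ be given by $$(\delta f)(a_1,\dots,a_{q+1})=\sum_{1\le j\le q}(-1)^j(a_jf)(a_1,\dots,\widehat{a_j},\dots,a_{q+1}).$$ A chain $g$ is called $D$-parallel if $ag=0$ for all $a\in\mathcal A$, and $\delta$-exact if it is of the form $\delta\eta$. Suppose that $(M,D)$ is hyperbolic, i.e. its universal covering $(\tilde M,\tilde D)$, with $\tilde D$ the pullback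 of $D$, is affinely isomorphic to a convex domain of $\mathbb R^n$ (with its standard flat connection) that contains no straight line, and suppose moreover that $(\tilde M,\tilde D)$ is affinely isomorphic to a convex cone in $\mathbb R^n$. Then there exists $H\in\mathcal A$ with $aH=a$ for all $a\in\mathcal A$, and every $D$-parallel 2-chain $g\in C_2(\mathcal A,W)$ is $\delta$-exact. More precisely, for every such $H$ the 1-chain $\theta(a)=g(H,a)$ satisfies $g=-\delta\theta$. -/

import Mathlib

open scoped Manifold ContDiff Bundle

noncomputable section

namespace KV

/-! ### Chains of a Koszul-Vinberg algebra and the coboundary operator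

`A` is a real vector space with a bilinear product `mul a b = ab`, and `W` a real vector space with
a left action `L a w = aw` and a right action `R w a = wa` of `A`. -/

section Algebra

variable {A W : Type*} [AddCommGroup A] [Module ℝ A] [AddCommGroup W] [Module ℝ W]

/-- `C_q(A, W)`: the `q`-linear maps from `A` to `W`. -/
abbrev Chain (q : ℕ) (A W : Type*) [AddCommGroup A] [Module ℝ A] [AddCommGroup W] [Module ℝ W] :=
  MultilinearMap ℝ (fun _ : Fin q => A) W

theorem compLinearMap_update_apply {q : ℕ} (f : Chain q A W) (j : Fin q) (g : A →ₗ[ℝ] A)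
    (v : Fin q → A) :
    f.compLinearMap (Function.update (fun _ => LinearMap.id) j g) v =
      f (Function.update v j (g (v j))) := by
  rw [MultilinearMap.compLinearMap_apply]
  congr 1
  ext i
  by_cases h : i = j
  · subst h; simp
  · simp [h]

/-- The left action of `A` on `C_q(A, W)`:
`(af)(a₁, …, a_q) = a (f(a₁, …, a_q)) - ∑ j, f(a₁, …, a a_j, …, a_q)`. -/
def act (mul : A →ₗ[ℝ] A →ₗ[ℝ] A) (L : A →ₗ[ℝ] W →ₗ[ℝ] W) {q : ℕ} (f : Chain q A W) :
    A →ₗ[ℝ] Chain q A W where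
  toFun a := (L a).compMultilinearMap f -
    ∑ j, f.compLinearMap (Function.update (fun _ => LinearMap.id) j (mul a))
  map_add' a b := by
    ext v
    simp only [sub_apply, sum_apply, compLinearMap_update_apply,
      LinearMap.compMultilinearMap_apply, map_add, LinearMap.add_apply, add_apply,
      MultilinearMap.map_update_add, Finset.sum_add_distrib]
    abel
  map_smul' r a := by
    ext v
    simp only [sub_apply, sum_apply, compLinearMap_update_apply,
      LinearMap.compMultilinearMap_apply, map_smul, LinearMap.smul_apply, smul_apply,
      MultilinearMap.map_update_smul, ← Finset.smul_sum, RingHom.id_apply, smul_sub]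

theorem act_apply (mul : A →ₗ[ℝ] A →ₗ[ℝ] A) (L : A →ₗ[ℝ] W →ₗ[ℝ] W) {q : ℕ} (f : Chain q A W)
    (a : A) (v : Fin q → A) :
    act mul L f a v = L a (f v) - ∑ j, f (Function.update v j (mul a (v j))) := by
  simp only [act, LinearMap.coe_mk, AddHom.coe_mk, sub_apply,
    sum_apply, compLinearMap_update_apply, LinearMap.compMultilinearMap_apply]

/-- For `f ∈ C_{q+1}(A, W)`, the map
`(a, (b₁, …, b_{q+1})) ↦ (e_{q+1}(a)(f b_{q+1}))(b₁, …, b_q) = (f(b₁, …, b_q, a)) b_{q+1}`. -/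
def actRight (R : W →ₗ[ℝ] A →ₗ[ℝ] W) {q : ℕ} (f : Chain (q + 1) A W) :
    A →ₗ[ℝ] Chain (q + 1) A W where
  toFun a := ((R.comp (LinearMap.applyₗ a)).compMultilinearMap f.curryRight).uncurryRight
  map_add' a b := by
    ext v; simp
  map_smul' r a := by
    ext v; simp

theorem actRight_apply (R : W →ₗ[ℝ] A →ₗ[ℝ] W) {q : ℕ} (f : Chain (q + 1) A W) (a : A)
    (b : Fin (q + 1) → A) :
    actRight R f a b = R (f (Fin.snoc (Fin.init b) a)) (b (Fin.last q)) := by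
  simp [actRight]

/-- The coboundary `δ : C_{q+1}(A, W) → C_{q+2}(A, W)`,
`(δf)(a₁, …, a_{q+2}) = ∑_{1 ≤ j < q+2} (-1)^j {(a_j f)(a₁, …, â_j, …, a_{q+2}) +
  (f(a₁, …, â_j, …, a_{q+1}, a_j)) a_{q+2}}`.
The index `j : Fin (q + 1)` below is the `j` of this formula minus one. -/
def coboundary (mul : A →ₗ[ℝ] A →ₗ[ℝ] A) (L : A →ₗ[ℝ] W →ₗ[ℝ] W) (R : W →ₗ[ℝ] A →ₗ[ℝ] W)
    {q : ℕ} (f : Chain (q + 1) A W) : Chain (q + 2) A W :=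
  ∑ j : Fin (q + 1), (-1 : ℝ) ^ ((j : ℕ) + 1) •
    (act mul L f + actRight R f).uncurryMid j.castSucc

theorem coboundary_apply (mul : A →ₗ[ℝ] A →ₗ[ℝ] A) (L : A →ₗ[ℝ] W →ₗ[ℝ] W)
    (R : W →ₗ[ℝ] A →ₗ[ℝ] W) {q : ℕ} (f : Chain (q + 1) A W) (a : Fin (q + 2) → A) :
    coboundary mul L R f a = ∑ j : Fin (q + 1), (-1 : ℝ) ^ ((j : ℕ) + 1) •
      (act mul L f (a j.castSucc) (j.castSucc.removeNth a) +
        actRight R f (a j.castSucc) (j.castSucc.removeNth a)) := by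
  simp [coboundary]

end Algebra

/-! ### Vector fields, functions, connections -/

section Geometry

variable {E : Type*} [NormedAddCommGroup E] [NormedSpace ℝ E]
  {M : Type*} [TopologicalSpace M] [ChartedSpace E M] [IsManifold 𝓘(ℝ, E) ∞ M]

/-- `𝒳(M)`, the real vector space of smooth vector fields on `M`. -/
abbrev VField (E : Type*) [NormedAddCommGroup E] [NormedSpace ℝ E]
    (M : Type*) [TopologicalSpace M] [ChartedSpace E M] [IsManifold 𝓘(ℝ, E) ∞ M] :=
  ContMDiffSection 𝓘(ℝ, E) E ∞ (TangentSpace 𝓘(ℝ, E) : M → Type _)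

/-- `C^∞(M, ℝ)`. -/
abbrev SmoothFun (E : Type*) [NormedAddCommGroup E] [NormedSpace ℝ E]
    (M : Type*) [TopologicalSpace M] [ChartedSpace E M] :=
  ContMDiffMap 𝓘(ℝ, E) 𝓘(ℝ, ℝ) M ℝ ∞

/-- Linear connections on (the tangent bundle of) `M`; `D b x (a x)` is `(D_a b)(x)`. -/
abbrev Connection (E : Type*) [NormedAddCommGroup E] [NormedSpace ℝ E]
    (M : Type*) [TopologicalSpace M] [ChartedSpace E M] [IsManifold 𝓘(ℝ, E) ∞ M] :=
  CovariantDerivative 𝓘(ℝ, E) E (TangentSpace 𝓘(ℝ, E) : M → Type _)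

/-- The left action `a w = ⟨dw, a⟩` of `𝒳(M)` on `C^∞(M, ℝ)`. -/
def derivAct : VField E M →ₗ[ℝ] SmoothFun E M →ₗ[ℝ] SmoothFun E M :=
  LinearMap.mk₂ ℝ
    (fun a w => ⟨fun x => mvfderiv 𝓘(ℝ, E) w x (a x), by
      have h := (w.contMDiff.contMDiff_tangentMap (m := ∞) (by simp)).comp a.contMDiff_toFun
      exact (contMDiff_snd_tangentBundle_modelSpace ℝ 𝓘(ℝ, ℝ)).comp h⟩)
    (fun a a' w => by ext x; exact map_add (mvfderiv 𝓘(ℝ, E) w x) (a x) (a' x))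
    (fun r a w => by ext x; exact map_smul (mvfderiv 𝓘(ℝ, E) w x) r (a x))
    (fun a w w' => by
      ext x
      have hw := w.contMDiff.contMDiffAt (x := x) |>.mdifferentiableAt (by simp)
      have hw' := w'.contMDiff.contMDiffAt (x := x) |>.mdifferentiableAt (by simp)
      exact congrArg (fun l => l (a x)) (mvfderiv_add hw hw'))
    (fun r a w => by
      ext x
      have hw := w.contMDiff.contMDiffAt (x := x) |>.mdifferentiableAt (by simp)
      have h := congrArg (fun l => l (a x))
        (mvfderiv_smul (a := fun _ => r) mdifferentiableAt_const hw)
      rw [mvfderiv_const] at h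
      refine h.trans ?_
      change r • mvfderiv 𝓘(ℝ, E) w x (a x) + (0 : ℝ) • w x = r • mvfderiv 𝓘(ℝ, E) w x (a x)
      simp)

/-! ### Affine maps, universal coverings, convex domains -/

theorem differentiableAt_of_section {σ : Π x : E, TangentSpace 𝓘(ℝ, E) x} {x : E}
    (h : MDiffAt (T% σ) x) : DifferentiableAt ℝ (fun y : E => (σ y : E)) x :=
  (((contMDiff_snd_tangentBundle_modelSpace (n := 1) E
    𝓘(ℝ, E)).contMDiffAt.mdifferentiableAt one_ne_zero).comp x h).differentiableAt

variable (E) in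
/-- The canonical flat connection of the vector space `E`. -/
def stdConnection : Connection E E where
  toFun σ x := fderiv ℝ (fun y : E => (σ y : E)) x
  isCovariantDerivativeOnUniv :=
    { add := by
        intro σ σ' x hσ hσ' _
        exact fderiv_add (E := E) (F := E) (differentiableAt_of_section hσ)
          (differentiableAt_of_section hσ')
      leibniz := by
        intro σ g x hσ hg _
        have h := fderiv_smul (F := E) hg.differentiableAt (differentiableAt_of_section hσ)
        refine h.trans ?_
        rw [mvfderiv, mfderiv_eq_fderiv]
        rfl }

variable {M' : Type*} [TopologicalSpace M'] [ChartedSpace E M'] [IsManifold 𝓘(ℝ, E) ∞ M']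

/-- `f : (M', D') → (M, D)` is an affine local diffeomorphism: a smooth local diffeomorphism with
`D' = f^*D`, that is `df (D'_v (f^*b)) = D_{df v} b` for every tangent vector `v` at a point `x` and
every vector field `b` differentiable at `f x`. -/
structure IsAffineLocalDiffeo (D' : Connection E M') (D : Connection E M) (f : M' → M) : Prop where
  isLocalDiffeomorph : IsLocalDiffeomorph 𝓘(ℝ, E) 𝓘(ℝ, E) ∞ f
  map_connection : ∀ (x : M') (b : Π y : M, TangentSpace 𝓘(ℝ, E) y), MDiffAt (T% b) (f x) →
    ∀ v : TangentSpace 𝓘(ℝ, E) x,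
      mfderiv 𝓘(ℝ, E) 𝓘(ℝ, E) f x (D' (VectorField.mpullback 𝓘(ℝ, E) 𝓘(ℝ, E) f b) x v) =
        D b (f x) (mfderiv 𝓘(ℝ, E) 𝓘(ℝ, E) f x v)

/-- `p : (M', D') → (M, D)` is the universal covering of `(M, D)`: `M'` is simply connected and `p`
is a surjective covering map along which `D'` is the pullback of `D`. -/
structure IsUniversalCovering (D' : Connection E M') (D : Connection E M) (p : M' → M) :
    Prop where
  simplyConnected : SimplyConnectedSpace M'
  isCoveringMap : IsCoveringMap p
  surjective : Function.Surjective p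
  isAffine : IsAffineLocalDiffeo D' D p

/-- `f` is an affine isomorphism of `(M, D)` onto the subset `Ω` of `E`, which carries the
restriction of the canonical connection. (As an injective local diffeomorphism, `f` is a
diffeomorphism onto its image, and `Ω` is open.) -/
structure IsAffineIsoOnto (D : Connection E M) (f : M → E) (Ω : Set E) : Prop where
  isAffine : IsAffineLocalDiffeo D (stdConnection E) f
  injective : Function.Injective f
  range_eq : Set.range f = Ω

/-- `Ω` does not contain any straight line. -/
def ContainsNoLine (Ω : Set E) : Prop :=
  ¬ ∃ x v : E, v ≠ 0 ∧ ∀ t : ℝ, x + t • v ∈ Ω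

/-- `(M, D)` is hyperbolic, expressed on its universal covering `(M', D')`: the latter is isomorphic
to a convex domain which does not contain any straight line. -/
def IsHyperbolicCover (D' : Connection E M') : Prop :=
  ∃ (Ω : Set E) (f : M' → E), Convex ℝ Ω ∧ ContainsNoLine Ω ∧ IsAffineIsoOnto D' f Ω

/-- `(M', D')` is isomorphic to a convex cone. -/
def IsIsoToConvexCone (D' : Connection E M') : Prop :=
  ∃ (C : ConvexCone ℝ E) (f : M' → E), IsAffineIsoOnto D' f (C : Set E)

/-! ### Locally flat structures and their complex -/

variable [CompleteSpace E] [FiniteDimensional ℝ E]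

variable (E M) in
/-- A locally flat structure on `M`: a smooth torsion-free linear connection whose curvature
`R(a, b) c = D_a D_b c - D_b D_a c - D_{[a, b]} c` vanishes. -/
structure LocallyFlat extends Connection E M where
  smooth : CovariantDerivative.ContMDiffCovariantDerivative toCovariantDerivative ∞
  torsion_eq_zero : toCovariantDerivative.torsion = 0
  curvature_eq_zero : ∀ (a b c : VField E M) (x : M),
    toFun (fun y => toFun c y (b y)) x (a x) - toFun (fun y => toFun c y (a y)) x (b x)
      - toFun c x (VectorField.mlieBracket 𝓘(ℝ, E) a b x) = 0

/-- The product `ab = D_a b` on `𝒳(M)`. -/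
def LocallyFlat.mul (D : LocallyFlat E M) : VField E M →ₗ[ℝ] VField E M →ₗ[ℝ] VField E M :=
  LinearMap.mk₂ ℝ
    (fun a b => ⟨fun x => D.toFun b x (a x), by
      have h := D.smooth.contMDiff.contMDiff (σ := b) b.contMDiff_toFun.contMDiffOn
      exact (contMDiffOn_univ.1 h).clm_bundle_apply a.contMDiff_toFun⟩)
    (fun a a' b => by ext x; simp)
    (fun r a b => by ext x; simp)
    (fun a b b' => by
      ext x
      have hb := b.contMDiff_toFun.contMDiffAt (x := x) |>.mdifferentiableAt (by simp)
      have hb' := b'.contMDiff_toFun.contMDiffAt (x := x) |>.mdifferentiableAt (by simp)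
      exact congrArg (fun l => l (a x)) (D.isCovariantDerivativeOnUniv.add hb hb'))
    (fun r a b => by
      ext x
      have hb := b.contMDiff_toFun.contMDiffAt (x := x) |>.mdifferentiableAt (by simp)
      exact congrArg (fun l => l (a x)) (D.isCovariantDerivativeOnUniv.smul_const r hb))

/-- The left action of `𝒳(M)` on `C_q(𝒳(M), C^∞(M, ℝ))`, i.e. the covariant derivative `D_a g`. -/
def LocallyFlat.act (D : LocallyFlat E M) {q : ℕ} (a : VField E M)
    (g : Chain q (VField E M) (SmoothFun E M)) : Chain q (VField E M) (SmoothFun E M) :=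
  KV.act D.mul derivAct g a

/-- `g` is `D`-parallel: `Dg = 0`. -/
def LocallyFlat.IsParallel (D : LocallyFlat E M) {q : ℕ}
    (g : Chain q (VField E M) (SmoothFun E M)) : Prop :=
  ∀ a : VField E M, D.act a g = 0

/-- The coboundary of the complex `C(𝒳(M), C^∞(M, ℝ))`; `C^∞(M, ℝ)` is a left module, its right
action is zero. -/
def LocallyFlat.δ (D : LocallyFlat E M) {q : ℕ}
    (g : Chain (q + 1) (VField E M) (SmoothFun E M)) :
    Chain (q + 2) (VField E M) (SmoothFun E M) :=
  coboundary D.mul derivAct 0 g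

/-- `g` is `δ`-exact. -/
def LocallyFlat.IsExact (D : LocallyFlat E M) {q : ℕ}
    (g : Chain (q + 2) (VField E M) (SmoothFun E M)) : Prop :=
  ∃ η : Chain (q + 1) (VField E M) (SmoothFun E M), D.δ η = g

end Geometry

end KV

end

namespace KV

set_option linter.unusedSectionVars false

open Filter Topology VectorField

/-! ### Pullback of vector fields along local diffeomorphisms, and affine maps -/

section LocalDiffeo

variable {E : Type*} [NormedAddCommGroup E] [NormedSpace ℝ E]
  {M : Type*} [TopologicalSpace M] [ChartedSpace E M] [IsManifold 𝓘(ℝ, E) ∞ M]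
  {M' : Type*} [TopologicalSpace M'] [ChartedSpace E M'] [IsManifold 𝓘(ℝ, E) ∞ M']
  {M'' : Type*} [TopologicalSpace M''] [ChartedSpace E M''] [IsManifold 𝓘(ℝ, E) ∞ M'']

/-! A right unit `H` of the algebra is a vector field with `D_a H = a`. Given one, evaluating `a g =
0` on the pair `(H, b)` yields `a (g(H, b)) = g(a, b) + g(H, ab)`, which is exactly `g = -δθ` for `θ
= g(H, ·)` (`eq_neg_coboundary_of_act_eq_zero`). The geometric work is to construct `H`.

On a cone `C` in a vector space, the radial (Euler) field `z ↦ z` has derivative the identity, so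
its pullback to the universal covering is a right unit there. It descends to `M` when deck
transformations preserve it. A deck transformation is affine, and any two affine charts, one of them
injective with convex image, differ by an affine map `z ↦ A z + c`
(`exists_affine_of_convex_range`); so it acts on `C` by such a map, and so does its inverse. If `c`
were nonzero, both `c` and `-c` would lie in the closure of the open cone, forcing a full line into
`C` (`eq_zero_of_affine_mapsTo_cone`). Hence `c = 0`, the action is linear, and linear maps preserve
the radial field.

Hyperbolicity and the cone condition come with possibly different charts; the same rigidity shows
that the cone contains no line (`IsAffineIsoOnto.containsNoLine`). -/

theorem isInvertible_mfderiv {f : M' → M} {x : M'}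
    (hf : IsLocalDiffeomorphAt 𝓘(ℝ, E) 𝓘(ℝ, E) ∞ f x) :
    (mfderiv 𝓘(ℝ, E) 𝓘(ℝ, E) f x).IsInvertible :=
  ⟨hf.mfderivToContinuousLinearEquiv (by simp), by ext; rfl⟩

theorem injective_mfderiv {f : M' → M} {x : M'}
    (hf : IsLocalDiffeomorphAt 𝓘(ℝ, E) 𝓘(ℝ, E) ∞ f x) :
    Function.Injective (mfderiv 𝓘(ℝ, E) 𝓘(ℝ, E) f x) :=
  (isInvertible_mfderiv hf).bijective.injective

theorem mfderiv_mpullback {f : M' → M} {x : M'}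
    (hf : IsLocalDiffeomorphAt 𝓘(ℝ, E) 𝓘(ℝ, E) ∞ f x) (V : Π y : M, TangentSpace 𝓘(ℝ, E) y) :
    mfderiv 𝓘(ℝ, E) 𝓘(ℝ, E) f x (mpullback 𝓘(ℝ, E) 𝓘(ℝ, E) f V x) = V (f x) := by
  obtain ⟨e, he⟩ := isInvertible_mfderiv hf
  rw [mpullback_apply, ← he, ContinuousLinearMap.inverse_equiv]
  exact e.apply_symm_apply _

theorem mpullback_comp {f : M'' → M'} {g : M' → M} {x : M''}
    (hf : IsLocalDiffeomorphAt 𝓘(ℝ, E) 𝓘(ℝ, E) ∞ f x)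
    (hg : IsLocalDiffeomorphAt 𝓘(ℝ, E) 𝓘(ℝ, E) ∞ g (f x))
    (V : Π y : M, TangentSpace 𝓘(ℝ, E) y) :
    mpullback 𝓘(ℝ, E) 𝓘(ℝ, E) (g ∘ f) V x =
      mpullback 𝓘(ℝ, E) 𝓘(ℝ, E) f (mpullback 𝓘(ℝ, E) 𝓘(ℝ, E) g V) x := by
  simp only [← mpullbackWithin_univ]
  refine mpullbackWithin_comp_of_left ?_ (Set.mapsTo_univ _ _) (uniqueMDiffWithinAt_univ _) ?_
  · exact (hf.mdifferentiableAt (by simp)).mdifferentiableWithinAt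
  · rw [mfderivWithin_univ]; exact isInvertible_mfderiv hg

theorem mpullback_eq_of_eventuallyEq_id {f : M → M} {x : M} (h : f =ᶠ[𝓝 x] id)
    (V : Π y : M, TangentSpace 𝓘(ℝ, E) y) :
    mpullback 𝓘(ℝ, E) 𝓘(ℝ, E) f V x = V x := by
  have h1 : (mfderiv 𝓘(ℝ, E) 𝓘(ℝ, E) f x : E →L[ℝ] E) = ContinuousLinearMap.id ℝ E :=
    (h.mfderiv_eq (I := 𝓘(ℝ, E)) (I' := 𝓘(ℝ, E))).trans mfderiv_id
  have h2 : (V (f x) : E) = V x := by rw [h.eq_of_nhds]; rfl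
  -- The tangent spaces at `f x` and `x` are different as dependent types, so the substitution is
  -- made after reading everything in `E`.
  have h3 : ∀ (A : E →L[ℝ] E) (v w : E), A = ContinuousLinearMap.id ℝ E → v = w →
      A.inverse v = w := by
    rintro A v w rfl rfl
    simp
  exact h3 _ _ _ h1 h2

theorem isLocalDiffeomorphAt_congr {f g : M' → M} {x : M'}
    (hf : IsLocalDiffeomorphAt 𝓘(ℝ, E) 𝓘(ℝ, E) ∞ f x) (h : g =ᶠ[𝓝 x] f) :
    IsLocalDiffeomorphAt 𝓘(ℝ, E) 𝓘(ℝ, E) ∞ g x := by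
  obtain ⟨Φ, hx, hΦ⟩ := hf
  obtain ⟨s, hs, hso, hxs⟩ := eventually_nhds_iff.1 h
  refine ⟨{ Φ.toOpenPartialHomeomorph.restrOpen s hso with
    contMDiffOn_toFun := Φ.contMDiffOn_toFun.mono Set.inter_subset_left
    contMDiffOn_invFun := Φ.contMDiffOn_invFun.mono Set.inter_subset_left }, ⟨hx, hxs⟩, ?_⟩
  intro y hy
  exact (hs y hy.2).trans (hΦ hy.1)

theorem isLocalDiffeomorphAt_localInverse {f : M' → M} {x : M'}
    (hf : IsLocalDiffeomorphAt 𝓘(ℝ, E) 𝓘(ℝ, E) ∞ f x) {y : M} (hy : y ∈ hf.localInverse.source) :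
    IsLocalDiffeomorphAt 𝓘(ℝ, E) 𝓘(ℝ, E) ∞ hf.localInverse y :=
  hf.localInverse.isLocalDiffeomorphAt _ _ _ hy

/-- Every field on the source is thus locally a pullback, so `map_connection`, which speaks only of
pullbacks, gives information on all of them. -/
theorem mpullback_mpullback_localInverse {f : M' → M}
    (hf : IsLocalDiffeomorph 𝓘(ℝ, E) 𝓘(ℝ, E) ∞ f) (x : M') (V : Π y : M', TangentSpace 𝓘(ℝ, E) y) :
    ∀ᶠ z in 𝓝 x, mpullback 𝓘(ℝ, E) 𝓘(ℝ, E) f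
      (mpullback 𝓘(ℝ, E) 𝓘(ℝ, E) (hf x).localInverse V) z = V z := by
  have h := (hf x).localInverse_eventuallyEq_left.eventuallyEq_nhds
  have hs : ∀ᶠ z in 𝓝 x, f z ∈ (hf x).localInverse.source :=
    (hf x).contMDiffAt.continuousAt.eventually
      ((hf x).localInverse.open_source.mem_nhds (hf x).localInverse_mem_source)
  filter_upwards [h, hs] with z hz hsz
  rw [← mpullback_comp (hf z) (isLocalDiffeomorphAt_localInverse (hf x) hsz)]
  exact mpullback_eq_of_eventuallyEq_id hz V

theorem mpullback_localInverse_mpullback {f : M' → M}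
    (hf : IsLocalDiffeomorph 𝓘(ℝ, E) 𝓘(ℝ, E) ∞ f) (x : M') (b : Π y : M, TangentSpace 𝓘(ℝ, E) y) :
    ∀ᶠ z in 𝓝 (f x), mpullback 𝓘(ℝ, E) 𝓘(ℝ, E) (hf x).localInverse
      (mpullback 𝓘(ℝ, E) 𝓘(ℝ, E) f b) z = b z := by
  have h := (hf x).localInverse_eventuallyEq_right.eventuallyEq_nhds
  have hs : ∀ᶠ z in 𝓝 (f x), z ∈ (hf x).localInverse.source :=
    (hf x).localInverse.open_source.mem_nhds (hf x).localInverse_mem_source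
  filter_upwards [h, hs] with z hz hsz
  rw [← mpullback_comp (isLocalDiffeomorphAt_localInverse (hf x) hsz) (hf _)]
  exact mpullback_eq_of_eventuallyEq_id hz b

variable [CompleteSpace E]

theorem mdifferentiableAt_mpullback {f : M' → M} {x : M'}
    (hf : IsLocalDiffeomorphAt 𝓘(ℝ, E) 𝓘(ℝ, E) ∞ f x) {b : Π y : M, TangentSpace 𝓘(ℝ, E) y}
    (hb : MDiffAt (T% b) (f x)) : MDiffAt (T% (mpullback 𝓘(ℝ, E) 𝓘(ℝ, E) f b)) x :=
  MDifferentiableAt.mpullback_vectorField hb hf.contMDiffAt (isInvertible_mfderiv hf)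
    (n := ∞) (by norm_cast)

theorem mdifferentiableAt_mpullback_localInverse {f : M' → M}
    (hf : IsLocalDiffeomorph 𝓘(ℝ, E) 𝓘(ℝ, E) ∞ f) (x : M') {V : Π y : M', TangentSpace 𝓘(ℝ, E) y}
    (hV : MDiffAt (T% V) x) :
    MDiffAt (T% (mpullback 𝓘(ℝ, E) 𝓘(ℝ, E) (hf x).localInverse V)) (f x) := by
  refine mdifferentiableAt_mpullback
    (isLocalDiffeomorphAt_localInverse _ (hf x).localInverse_mem_source) ?_
  rwa [(hf x).localInverse_left_inv (hf x).localInverse_mem_target]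

theorem contMDiffAt_of_mpullback {f : M' → M}
    (hf : IsLocalDiffeomorph 𝓘(ℝ, E) 𝓘(ℝ, E) ∞ f) (x : M') {b : Π y : M, TangentSpace 𝓘(ℝ, E) y}
    (hb : CMDiffAt ∞ (T% (mpullback 𝓘(ℝ, E) 𝓘(ℝ, E) f b)) x) :
    CMDiffAt ∞ (T% b) (f x) := by
  have hs := isLocalDiffeomorphAt_localInverse (hf x) (hf x).localInverse_mem_source
  have h := ContMDiffAt.mpullback_vectorField_preimage (m := ∞) (n := ∞)
    (V := mpullback 𝓘(ℝ, E) 𝓘(ℝ, E) f b) (f := (hf x).localInverse) (x₀ := f x)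
    (by rwa [(hf x).localInverse_left_inv (hf x).localInverse_mem_target])
    hs.contMDiffAt (isInvertible_mfderiv hs) (by simp)
  refine h.congr_of_eventuallyEq ?_
  filter_upwards [mpullback_localInverse_mpullback hf x b] with z hz
  rw [hz]

theorem Connection.congr_of_eventuallyEq (D : Connection E M) {b b' : Π y : M, TangentSpace 𝓘(ℝ, E) y}
    {x : M} (hb : MDiffAt (T% b) x) (hb' : MDiffAt (T% b') x) (h : ∀ᶠ y in 𝓝 x, b y = b' y) :
    D b x = D b' x :=
  D.isCovariantDerivativeOnUniv.congr_of_eventuallyEq hb hb' univ_mem h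

namespace IsAffineLocalDiffeo

variable {D'' : Connection E M''} {D' : Connection E M'} {D : Connection E M}

theorem comp {f : M'' → M'} {g : M' → M} (hg : IsAffineLocalDiffeo D' D g)
    (hf : IsAffineLocalDiffeo D'' D' f) : IsAffineLocalDiffeo D'' D (g ∘ f) where
  isLocalDiffeomorph x := (hf.1 x).comp 𝓘(ℝ, E) M (hg.1 (f x))
  map_connection x b hb v := by
    have h : mpullback 𝓘(ℝ, E) 𝓘(ℝ, E) (g ∘ f) b =
        mpullback 𝓘(ℝ, E) 𝓘(ℝ, E) f (mpullback 𝓘(ℝ, E) 𝓘(ℝ, E) g b) :=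
      funext fun x => mpullback_comp (hf.1 x) (hg.1 (f x)) b
    have hc := mfderiv_comp x ((hg.1 (f x)).mdifferentiableAt (by simp))
      ((hf.1 x).mdifferentiableAt (by simp))
    rw [h, hc]
    refine (congrArg (mfderiv 𝓘(ℝ, E) 𝓘(ℝ, E) g (f x)) (hf.2 x _
      (mdifferentiableAt_mpullback (hg.1 (f x)) hb) v)).trans ?_
    exact hg.2 (f x) b hb _

theorem isLocalDiffeomorph_of_comp {f : M'' → M'} {g : M' → M}
    (hg : IsLocalDiffeomorph 𝓘(ℝ, E) 𝓘(ℝ, E) ∞ g) (hf : Continuous f)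
    (hgf : IsLocalDiffeomorph 𝓘(ℝ, E) 𝓘(ℝ, E) ∞ (g ∘ f)) :
    IsLocalDiffeomorph 𝓘(ℝ, E) 𝓘(ℝ, E) ∞ f := by
  intro x
  refine isLocalDiffeomorphAt_congr ((hgf x).comp 𝓘(ℝ, E) M'
    (isLocalDiffeomorphAt_localInverse (hg (f x)) (hg (f x)).localInverse_mem_source)) ?_
  exact (hf.continuousAt.eventually (hg (f x)).localInverse_eventuallyEq_left).mono
    fun z hz => hz.symm

/-- Affineness can be cancelled on the left. A field `b` near `f x` is `g^*c` for its push-forward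
`c` by `g`, and then `(g ∘ f)^*c = f^*b` near `x`; comparing the identities for `g ∘ f` and `g` on
`c`, one cancels the injective `dg`. This makes lifts of the covering map affine. -/
theorem of_comp {f : M'' → M'} {g : M' → M} (hg : IsAffineLocalDiffeo D' D g) (hf : Continuous f)
    (hgf : IsAffineLocalDiffeo D'' D (g ∘ f)) : IsAffineLocalDiffeo D'' D' f where
  isLocalDiffeomorph := isLocalDiffeomorph_of_comp hg.1 hf hgf.1
  map_connection x b hb v := by
    have hf1 := isLocalDiffeomorph_of_comp hg.1 hf hgf.1
    set c := mpullback 𝓘(ℝ, E) 𝓘(ℝ, E) (hg.1 (f x)).localInverse b with hc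
    have hcd : MDiffAt (T% c) (g (f x)) := mdifferentiableAt_mpullback_localInverse hg.1 (f x) hb
    have hcb := mpullback_mpullback_localInverse hg.1 (f x) b
    have hcd' := mdifferentiableAt_mpullback (hg.1 (f x)) hcd
    have h1 : D' (mpullback 𝓘(ℝ, E) 𝓘(ℝ, E) g c) (f x) = D' b (f x) :=
      Connection.congr_of_eventuallyEq D' hcd' hb hcb
    have h2 : D'' (mpullback 𝓘(ℝ, E) 𝓘(ℝ, E) (g ∘ f) c) x =
        D'' (mpullback 𝓘(ℝ, E) 𝓘(ℝ, E) f b) x := by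
      refine Connection.congr_of_eventuallyEq D'' (mdifferentiableAt_mpullback (hgf.1 x) hcd)
        (mdifferentiableAt_mpullback (hf1 x) hb) ?_
      filter_upwards [hf.continuousAt.eventually hcb] with z hz
      rw [mpullback_comp (hf1 z) (hg.1 (f z)), mpullback_apply, hz, mpullback_apply]
    have hcomp := mfderiv_comp x ((hg.1 (f x)).mdifferentiableAt (by simp))
      ((hf1 x).mdifferentiableAt (by simp))
    have h3 := hgf.2 x c hcd v
    rw [h2, hcomp] at h3
    have h4 := hg.2 (f x) c hcd (mfderiv 𝓘(ℝ, E) 𝓘(ℝ, E) f x v)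
    rw [h1] at h4
    exact injective_mfderiv (hg.1 (f x)) (h3.trans h4.symm)

end IsAffineLocalDiffeo

end LocalDiffeo

/-! ### Rigidity of affine charts -/

section Rigidity

variable {E : Type*} [NormedAddCommGroup E] [NormedSpace ℝ E] [CompleteSpace E]
  {M : Type*} [TopologicalSpace M] [ChartedSpace E M] [IsManifold 𝓘(ℝ, E) ∞ M]

theorem mdifferentiableAt_vectorField {σ : Π x : E, TangentSpace 𝓘(ℝ, E) x} {x : E}
    (h : DifferentiableAt ℝ (fun y : E => (σ y : E)) x) : MDiffAt (T% σ) x := by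
  rw [mdifferentiableAt_section]
  simpa using! h.mdifferentiableAt

theorem contMDiffAt_vectorField {σ : Π x : E, TangentSpace 𝓘(ℝ, E) x} {x : E}
    (h : ContDiffAt ℝ ∞ (fun y : E => (σ y : E)) x) : CMDiffAt ∞ (T% σ) x := by
  rw [Bundle.contMDiffAt_section]
  simpa using! h.contMDiffAt

theorem fderiv_comp_mfderiv {f k : M → E} {F : E → E} {x : M} (hk : k = F ∘ f)
    (hF : DifferentiableAt ℝ F (f x)) (hf : MDiffAt f x) (w : TangentSpace 𝓘(ℝ, E) x) :
    (mfderiv 𝓘(ℝ, E) 𝓘(ℝ, E) k x w : E) = fderiv ℝ F (f x) (mfderiv 𝓘(ℝ, E) 𝓘(ℝ, E) f x w) := by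
  subst hk
  have h := mfderiv_comp x hF.mdifferentiableAt hf
  rw [mfderiv_eq_fderiv] at h
  rw [h]
  rfl

variable {D : Connection E M} {f k : M → E}

/-- Two developing maps of the same flat structure differ by an affine map, if one of them is
injective with convex image. -/
theorem exists_affine_of_convex_range (hf : IsAffineLocalDiffeo D (stdConnection E) f)
    (hk : IsAffineLocalDiffeo D (stdConnection E) k) (inj : Function.Injective f)
    (conv : Convex ℝ (Set.range f)) : ∃ (A : E →L[ℝ] E) (c : E), ∀ x, k x = A (f x) + c := by
  cases isEmpty_or_nonempty M with
  | inl h => exact ⟨0, 0, fun x => isEmptyElim x⟩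
  | inr h =>
  obtain ⟨x₀⟩ := id h
  let g : E → M := Function.invFun f
  have gf : ∀ x, g (f x) = x := Function.leftInverse_invFun inj
  -- The transition map between the two charts; only its values on the open set `range f` matter.
  let F : E → E := k ∘ g
  have hkF : k = F ∘ f := funext fun x => (congrArg k (gf x)).symm
  have hg : ∀ x, g =ᶠ[𝓝 (f x)] (hf.1 x).localInverse := fun x => by
    filter_upwards [(hf.1 x).localInverse.open_source.mem_nhds (hf.1 x).localInverse_mem_source]
      with y hy
    have h1 := (hf.1 x).localInverse_right_inv hy
    exact (congrArg g h1.symm).trans (gf _)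
  have hgc : ∀ x, CMDiffAt ∞ g (f x) := fun x =>
    (hf.1 x).localInverse_contMDiffAt.congr_of_eventuallyEq (hg x)
  have hFc : ∀ x, ContDiffAt ℝ ∞ F (f x) := fun x => by
    rw [← contMDiffAt_iff_contDiffAt]
    exact ContMDiffAt.comp (f x) (by rw [gf]; exact (hk.1 x).contMDiffAt) (hgc x)
  have hFd : ∀ x, DifferentiableAt ℝ F (f x) := fun x => (hFc x).differentiableAt (by simp)
  -- The second derivative of `F` vanishes. The constant field `v` pulls back to a field `β` with
  -- `Dβ = 0` at `x`, whose push-forward `b` by `k` has zero derivative at `k x`. Near `f x` one has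
  -- `dF(v) = b ∘ F`, so the chain rule concludes.
  have key : ∀ (v : E) (x : M), HasFDerivAt (fun y => fderiv ℝ F y v) (0 : E →L[ℝ] E) (f x) := by
    intro v x
    let c : Π y : E, TangentSpace 𝓘(ℝ, E) y := fun _ => v
    have hc : ∀ y, MDiffAt (T% c) y := fun y =>
      mdifferentiableAt_vectorField (σ := c) (differentiableAt_const v)
    let β := mpullback 𝓘(ℝ, E) 𝓘(ℝ, E) f c
    have hβ : MDiffAt (T% β) x := mdifferentiableAt_mpullback (hf.1 x) (hc _)
    have hDβ : ∀ w, D β x w = 0 := fun w => by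
      apply injective_mfderiv (hf.1 x)
      rw [hf.2 x c (hc _) w, map_zero]
      exact congrArg (fun L : E →L[ℝ] E => L _) ((hasFDerivAt_const (𝕜 := ℝ) v (f x)).fderiv)
    let b := mpullback 𝓘(ℝ, E) 𝓘(ℝ, E) (hk.1 x).localInverse β
    have hb : MDiffAt (T% b) (k x) := mdifferentiableAt_mpullback_localInverse hk.1 x hβ
    have hbβ := mpullback_mpullback_localInverse hk.1 x β
    have hDb : ∀ u : E, fderiv ℝ (fun y => (b y : E)) (k x) u = 0 := fun u => by
      obtain ⟨w, rfl⟩ := (isInvertible_mfderiv (hk.1 x)).bijective.surjective u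
      have h1 := hk.2 x b hb w
      rw [Connection.congr_of_eventuallyEq D (mdifferentiableAt_mpullback (hk.1 x) hb) hβ hbβ,
        hDβ, map_zero] at h1
      exact h1.symm
    have hbd : DifferentiableAt ℝ (fun y => (b y : E)) (F (f x)) := by
      rw [← Function.comp_apply (f := F), ← hkF]
      exact differentiableAt_of_section hb
    have hcomp := hbd.hasFDerivAt.comp (f x) (hFd x).hasFDerivAt
    have hz : fderiv ℝ (fun y => (b y : E)) (F (f x)) = 0 := by
      rw [← Function.comp_apply (f := F), ← hkF]
      exact ContinuousLinearMap.ext hDb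
    rw [hz, ContinuousLinearMap.zero_comp] at hcomp
    refine hcomp.congr_of_eventuallyEq ?_
    have hgx : Tendsto g (𝓝 (f x)) (𝓝 x) := by
      have := (hgc x).continuousAt.tendsto
      rwa [gf] at this
    filter_upwards [hgx.eventually hbβ, hf.1.isOpen_range.mem_nhds ⟨x, rfl⟩] with y hy hyr
    obtain ⟨z, rfl⟩ := hyr
    rw [gf] at hy
    have h1 := fderiv_comp_mfderiv hkF (hFd z) ((hf.1 z).mdifferentiableAt (by simp)) (β z)
    have h2 : (mfderiv 𝓘(ℝ, E) 𝓘(ℝ, E) f z (β z) : E) = v := mfderiv_mpullback (hf.1 z) c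
    have h3 : (mfderiv 𝓘(ℝ, E) 𝓘(ℝ, E) k z (β z) : E) = b (k z) := by
      rw [← hy]
      exact mfderiv_mpullback (hk.1 z) b
    rw [h2, h3] at h1
    exact h1.symm.trans (congrArg (fun y => (b y : E)) (congrFun hkF z))
  have hopen := hf.1.isOpen_range
  have hpre := conv.isPreconnected
  have hA : ∀ x, fderiv ℝ F (f x) = fderiv ℝ F (f x₀) := fun x => by
    ext1 v
    refine hopen.is_const_of_fderiv_eq_zero (𝕜 := ℝ) hpre (f := fun y => fderiv ℝ F y v) ?_ ?_
      ⟨x, rfl⟩ ⟨x₀, rfl⟩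
    · rintro _ ⟨z, rfl⟩
      exact (key v z).differentiableAt.differentiableWithinAt
    · rintro _ ⟨z, rfl⟩
      exact (key v z).fderiv
  refine ⟨fderiv ℝ F (f x₀), F (f x₀) - fderiv ℝ F (f x₀) (f x₀), fun x => ?_⟩
  have hd : ∀ z, HasFDerivAt (fun y => F y - fderiv ℝ F (f x₀) y) (0 : E →L[ℝ] E) (f z) :=
    fun z => by
      have h1 := (hFd z).hasFDerivAt.sub (fderiv ℝ F (f x₀)).hasFDerivAt
      rwa [hA z, sub_self] at h1
  have h1 := hopen.is_const_of_fderiv_eq_zero (𝕜 := ℝ) hpre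
    (f := fun y => F y - fderiv ℝ F (f x₀) y)
    (by rintro _ ⟨z, rfl⟩; exact (hd z).differentiableAt.differentiableWithinAt)
    (by rintro _ ⟨z, rfl⟩; exact (hd z).fderiv) ⟨x, rfl⟩ ⟨x₀, rfl⟩
  rw [← h1, hkF]
  simp

theorem mfderiv_eq_of_affine (hf : IsAffineLocalDiffeo D (stdConnection E) f)
    {A : E →L[ℝ] E} {c : E} (h : ∀ x, k x = A (f x) + c) (x : M) (w : TangentSpace 𝓘(ℝ, E) x) :
    (mfderiv 𝓘(ℝ, E) 𝓘(ℝ, E) k x w : E) = A (mfderiv 𝓘(ℝ, E) 𝓘(ℝ, E) f x w) := by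
  have hA : HasFDerivAt (fun y => A y + c) A (f x) := A.hasFDerivAt.add_const c
  rw [fderiv_comp_mfderiv (F := fun y => A y + c) (funext h) hA.differentiableAt
    ((hf.1 x).mdifferentiableAt (by simp)), hA.fderiv]

/-- The differentials satisfy `dk = A ∘ df`, with `df` onto and `dk` injective. -/
theorem injective_of_affine [Nonempty M] (hf : IsAffineLocalDiffeo D (stdConnection E) f)
    (hk : IsAffineLocalDiffeo D (stdConnection E) k)
    {A : E →L[ℝ] E} {c : E} (h : ∀ x, k x = A (f x) + c) : Function.Injective A := by
  obtain ⟨x⟩ := ‹Nonempty M›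
  intro u v huv
  obtain ⟨u', hu⟩ := (isInvertible_mfderiv (hf.1 x)).bijective.surjective u
  obtain ⟨v', hv⟩ := (isInvertible_mfderiv (hf.1 x)).bijective.surjective v
  have : u' = v' := by
    apply injective_mfderiv (hk.1 x)
    refine (mfderiv_eq_of_affine hf h x u').trans ((Eq.trans ?_ huv).trans
      (Eq.trans ?_ (mfderiv_eq_of_affine hf h x v').symm))
    · exact congrArg A hu
    · exact congrArg A hv.symm
  rw [← hu, ← hv, this]

/-- The transition map is affine with injective linear part, so it carries a line in `Ω` to a line
in `Ω'`. -/
theorem IsAffineIsoOnto.containsNoLine [Nonempty M] {Ω Ω' : Set E}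
    (hf : IsAffineIsoOnto D f Ω) (hk : IsAffineIsoOnto D k Ω') (conv : Convex ℝ Ω)
    (h : ContainsNoLine Ω') : ContainsNoLine Ω := by
  rintro ⟨x, v, hv, hl⟩
  obtain ⟨A, c, hA⟩ := exists_affine_of_convex_range hf.1 hk.1 hf.2 (hf.3 ▸ conv)
  refine h ⟨A x + c, A v, fun h0 => hv ?_, fun t => ?_⟩
  · exact injective_of_affine hf.1 hk.1 hA (h0.trans (map_zero A).symm)
  · obtain ⟨z, hz⟩ := hf.3.symm ▸ hl t
    rw [← hk.3]
    refine ⟨z, ?_⟩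
    rw [hA, hz, map_add, map_smul]
    abel

end Rigidity

/-! ### Affine self-maps of open convex cones -/

section Cone

variable {E : Type*} [NormedAddCommGroup E] [NormedSpace ℝ E]

/-- Write `u + w = (u + (w - w')) + w'` with `w'` in `C` close enough to `w` that the first summand
stays in `C`. -/
theorem ConvexCone.add_mem_of_mem_closure {C : ConvexCone ℝ E} (hC : IsOpen (C : Set E)) {u w : E}
    (hu : u ∈ C) (hw : w ∈ closure (C : Set E)) : u + w ∈ C := by
  have h : ∀ᶠ w' in 𝓝 w, u + (w - w') ∈ (C : Set E) := by
    have hc : Continuous fun w' => u + (w - w') := by fun_prop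
    refine hc.continuousAt.eventually (hC.mem_nhds ?_)
    simpa using hu
  obtain ⟨w', h1, h2⟩ := (mem_closure_iff_frequently.1 hw).and_eventually h |>.exists
  have := C.add_mem h2 h1
  rwa [add_assoc, sub_add_cancel] at this

/-- An affine bijection of an open convex cone without lines fixes the vertex. -/
theorem eq_zero_of_affine_mapsTo_cone {C : ConvexCone ℝ E} (hC : IsOpen (C : Set E))
    (hne : (C : Set E).Nonempty) (hline : ContainsNoLine (C : Set E)) {A B : E →L[ℝ] E} {c d : E}
    (hA : ∀ z ∈ C, A z + c ∈ C) (hB : ∀ z ∈ C, B z + d ∈ C)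
    (hAB : ∀ z ∈ C, A (B z + d) + c = z) : c = 0 := by
  obtain ⟨u, hu⟩ := hne
  -- The vertex need not belong to `C`, so it is approached along the ray through `u`.
  have zero_lim : ∀ {F : E → E}, Continuous F →
      Tendsto (fun t : ℝ => F (t • u)) (𝓝[>] 0) (𝓝 (F 0)) := fun {F} hF => by
    have h : Continuous fun t : ℝ => F (t • u) := by fun_prop
    have := h.tendsto 0
    rw [zero_smul] at this
    exact this.mono_left nhdsWithin_le_nhds
  have vertex : ∀ {A : E →L[ℝ] E} {c : E}, (∀ z ∈ C, A z + c ∈ C) → c ∈ closure (C : Set E) := by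
    intro A c hA
    have h := zero_lim (F := fun z => A z + c) (by fun_prop)
    simp only [map_zero, zero_add] at h
    refine mem_closure_of_tendsto h ?_
    filter_upwards [self_mem_nhdsWithin] with t ht
    exact hA _ (C.smul_mem ht hu)
  have hc := vertex hA
  have hd := vertex hB
  -- Rescaling kills the translation: `t (A (z / t) + c) = A z + t c` lies in `C` and tends to `A z`
  -- as `t → 0⁺`.
  have linear : ∀ z ∈ C, A z ∈ closure (C : Set E) := fun z hz => by
    have h : Tendsto (fun t : ℝ => A z + t • c) (𝓝[>] 0) (𝓝 (A z)) := by
      have h : Continuous fun t : ℝ => A z + t • c := by fun_prop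
      have := h.tendsto 0
      rw [zero_smul, add_zero] at this
      exact this.mono_left nhdsWithin_le_nhds
    refine mem_closure_of_tendsto h ?_
    filter_upwards [self_mem_nhdsWithin] with t ht
    have := C.smul_mem (Set.mem_Ioi.1 ht) (hA _ (C.smul_mem (inv_pos.2 ht) hz))
    rwa [smul_add, map_smul, smul_inv_smul₀ (ne_of_gt ht)] at this
  have hAd : A d ∈ closure (C : Set E) :=
    closure_minimal (s := (C : Set E)) (t := A ⁻¹' closure (C : Set E)) linear
      (isClosed_closure.preimage A.continuous) hd
  -- Let `z` tend to the vertex in `A (B z + d) + c = z`. Then `-c = A d` is in the closure of `C`,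
  -- as `c` is.
  have hAdc : A d + c = 0 := by
    have h1 := zero_lim (F := fun z => A (B z + d) + c) (by fun_prop)
    have h2 := zero_lim (F := id) continuous_id
    simp only [map_zero, zero_add] at h1
    refine tendsto_nhds_unique (h1.congr' ?_) h2
    filter_upwards [self_mem_nhdsWithin] with t ht
    exact hAB _ (C.smul_mem ht hu)
  have hnc : -c ∈ closure (C : Set E) := by rwa [← eq_neg_of_add_eq_zero_left hAdc]
  have smul_closure : ∀ {w : E} {t : ℝ}, 0 < t → w ∈ closure (C : Set E) →
      t • w ∈ closure (C : Set E) := fun ht hw =>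
    (C.closure).smul_mem ht hw
  by_contra h0
  -- With `±c` in the closure, adding any multiple of `c` to the interior point `u` stays in `C`.
  refine hline ⟨u, c, h0, fun t => ?_⟩
  rcases lt_trichotomy t 0 with ht | rfl | ht
  · have := ConvexCone.add_mem_of_mem_closure hC hu (smul_closure (neg_pos.2 ht) hnc)
    rwa [smul_neg, neg_smul, neg_neg] at this
  · simpa using hu
  · exact ConvexCone.add_mem_of_mem_closure hC hu (smul_closure ht hc)

end Cone

/-! ### Deck transformations and descent of the radial field -/

section Radial

variable {E : Type*} [NormedAddCommGroup E] [NormedSpace ℝ E] [CompleteSpace E]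
  {M : Type*} [TopologicalSpace M] [ChartedSpace E M] [IsManifold 𝓘(ℝ, E) ∞ M]
  {M' : Type*} [TopologicalSpace M'] [ChartedSpace E M'] [IsManifold 𝓘(ℝ, E) ∞ M']
  {D : Connection E M} {D' : Connection E M'} {p : M' → M}

/-- The deck transformations of the universal covering are affine and transitive on fibres. -/
theorem IsUniversalCovering.exists_deckTransformation (hp : IsUniversalCovering D' D p) {x y : M'}
    (h : p x = p y) : ∃ τ σ : M' → M', τ x = y ∧ p ∘ τ = p ∧ τ ∘ σ = id ∧
      IsAffineLocalDiffeo D' D' τ ∧ IsAffineLocalDiffeo D' D' σ := by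
  have := hp.simplyConnected
  have : LocallyPathConnectedSpace M' := ChartedSpace.locallyPathConnectedSpace E M'
  have hpc := hp.isCoveringMap
  obtain ⟨τ, ⟨hτx, hτ⟩, -⟩ :=
    hpc.existsUnique_continuousMap_lifts ⟨p, hpc.continuous⟩ x y h.symm
  obtain ⟨σ, ⟨hσy, hσ⟩, -⟩ :=
    hpc.existsUnique_continuousMap_lifts ⟨p, hpc.continuous⟩ y x h
  have hτ' : p ∘ τ = p := hτ
  have hσ' : p ∘ σ = p := hσ
  refine ⟨τ, σ, hτx, hτ, ?_, ?_, ?_⟩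
  -- Both `τ ∘ σ` and the identity lift `p` and fix `y`, so they agree by uniqueness of lifts.
  · refine hpc.eq_of_comp_eq (τ.continuous.comp σ.continuous) continuous_id ?_ y ?_
    · rw [← Function.comp_assoc, hτ', hσ', Function.comp_id]
    · simp [hσy, hτx]
  · exact hp.isAffine.of_comp τ.continuous (by rw [hτ']; exact hp.isAffine)
  · exact hp.isAffine.of_comp σ.continuous (by rw [hσ']; exact hp.isAffine)

/-- The radial vector field of `E`, read in the affine coordinates `f`. -/
noncomputable def radialField (f : M' → E) : Π x : M', TangentSpace 𝓘(ℝ, E) x :=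
  mpullback 𝓘(ℝ, E) 𝓘(ℝ, E) f (fun y : E => (y : TangentSpace 𝓘(ℝ, E) y))

theorem mfderiv_radialField {f : M' → E} (hf : IsLocalDiffeomorph 𝓘(ℝ, E) 𝓘(ℝ, E) ∞ f) (x : M') :
    (mfderiv 𝓘(ℝ, E) 𝓘(ℝ, E) f x (radialField f x) : E) = f x :=
  mfderiv_mpullback (hf x) _

theorem contMDiff_radialField {f : M' → E} (hf : IsLocalDiffeomorph 𝓘(ℝ, E) 𝓘(ℝ, E) ∞ f) :
    CMDiff ∞ (T% (radialField f)) := by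
  exact fun x => ContMDiffAt.mpullback_vectorField_preimage (m := ∞) (n := ∞)
    (contMDiffAt_vectorField (σ := fun y : E => (y : TangentSpace 𝓘(ℝ, E) y)) contDiffAt_id)
    (hf x).contMDiffAt (isInvertible_mfderiv (hf x)) (by simp)

theorem connection_radialField {f : M' → E} (hf : IsAffineLocalDiffeo D' (stdConnection E) f)
    (x : M') (v : TangentSpace 𝓘(ℝ, E) x) : D' (radialField f) x v = v := by
  apply injective_mfderiv (hf.1 x)
  refine (hf.2 x _ (mdifferentiableAt_vectorField (σ := fun y : E => (y : TangentSpace 𝓘(ℝ, E) y))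
    differentiableAt_id) v).trans ?_
  exact congrArg (fun L : E →L[ℝ] E => L _) (fderiv_fun_id (𝕜 := ℝ) (x := f x))

variable {f : M' → E} {C : ConvexCone ℝ E}

/-- Two points of a fibre are exchanged by a deck transformation, which reads in the chart `f` as a
linear map since its translation part vanishes on a cone without lines. It therefore preserves the
radial field, and `p ∘ τ = p` transports this to `M`. -/
theorem mfderiv_radialField_eq (hp : IsUniversalCovering D' D p)
    (hf : IsAffineIsoOnto D' f (C : Set E)) (hline : ContainsNoLine (C : Set E)) {x y : M'}
    (h : p x = p y) :
    (mfderiv 𝓘(ℝ, E) 𝓘(ℝ, E) p x (radialField f x) : E) =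
      mfderiv 𝓘(ℝ, E) 𝓘(ℝ, E) p y (radialField f y) := by
  obtain ⟨τ, σ, hxy, hpτ, hτσ, hτ, hσ⟩ := hp.exists_deckTransformation h
  have conv : Convex ℝ (Set.range f) := hf.3 ▸ C.convex
  obtain ⟨A, c, hA⟩ := exists_affine_of_convex_range hf.1 (hf.1.comp hτ) hf.2 conv
  obtain ⟨B, d, hB⟩ := exists_affine_of_convex_range hf.1 (hf.1.comp hσ) hf.2 conv
  simp only [Function.comp_apply] at hA hB
  have hmem : ∀ z, f z ∈ C := fun z => by
    rw [← SetLike.mem_coe, ← hf.3]; exact ⟨z, rfl⟩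
  have hex : ∀ u ∈ C, ∃ z, f z = u := fun u hu => by
    rwa [← SetLike.mem_coe, ← hf.3] at hu
  have hc : c = 0 := by
    refine eq_zero_of_affine_mapsTo_cone (hf.3 ▸ hf.1.1.isOpen_range) ⟨f x, hmem x⟩ hline
      (A := A) (B := B) (d := d) ?_ ?_ ?_
    · intro u hu
      obtain ⟨z, rfl⟩ := hex u hu
      rw [← hA]; exact hmem _
    · intro u hu
      obtain ⟨z, rfl⟩ := hex u hu
      rw [← hB]; exact hmem _
    · intro u hu
      obtain ⟨z, rfl⟩ := hex u hu
      rw [← hB, ← hA, ← Function.comp_apply (f := τ), hτσ, id]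
  subst hc
  subst hxy
  have hfτ := mfderiv_comp x ((hf.1.1 (τ x)).mdifferentiableAt (by simp))
    ((hτ.1 x).mdifferentiableAt (by simp))
  have h1 : mfderiv 𝓘(ℝ, E) 𝓘(ℝ, E) τ x (radialField f x) = radialField f (τ x) := by
    apply injective_mfderiv (hf.1.1 (τ x))
    have h2 := congrArg (fun L => L (radialField f x)) hfτ
    refine Eq.trans (Eq.trans h2.symm (mfderiv_eq_of_affine hf.1 hA x _))
      (Eq.trans ?_ (mfderiv_radialField hf.1.1 (τ x)).symm)
    rw [mfderiv_radialField hf.1.1, hA, add_zero]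
  have hpτ' := mfderiv_comp x ((hp.isAffine.1 (τ x)).mdifferentiableAt (by simp))
    ((hτ.1 x).mdifferentiableAt (by simp))
  rw [hpτ] at hpτ'
  have h3 := congrArg (fun L : E →L[ℝ] E => L (radialField f x)) hpτ'
  exact h3.trans (congrArg (mfderiv 𝓘(ℝ, E) 𝓘(ℝ, E) p (τ x)) h1)

/-- The radial vector field of the cone descends to the quotient `M`. -/
theorem exists_mpullback_eq_radialField (hp : IsUniversalCovering D' D p)
    (hf : IsAffineIsoOnto D' f (C : Set E)) (hline : ContainsNoLine (C : Set E)) :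
    ∃ H : Π x : M, TangentSpace 𝓘(ℝ, E) x, mpullback 𝓘(ℝ, E) 𝓘(ℝ, E) p H = radialField f := by
  -- An arbitrary, possibly discontinuous choice of preimages: the value of `H` does not depend on
  -- it, and smoothness is recovered from the pullback.
  let s := Function.surjInv hp.surjective
  have hs : ∀ z, p (s z) = z := Function.surjInv_eq hp.surjective
  let H : Π x : M, TangentSpace 𝓘(ℝ, E) x := fun z =>
    (mfderiv 𝓘(ℝ, E) 𝓘(ℝ, E) p (s z) (radialField f (s z)) : E)
  refine ⟨H, funext fun x => injective_mfderiv (hp.isAffine.1 x) ?_⟩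
  rw [mfderiv_mpullback (hp.isAffine.1 x)]
  exact mfderiv_radialField_eq hp hf hline (hs (p x))

/-- Smoothness and `D_v H = v` are local conditions, so they are checked on the covering, where the
pullback of `H` is the radial field. -/
theorem exists_radial_vectorField (hp : IsUniversalCovering D' D p)
    (hf : IsAffineIsoOnto D' f (C : Set E)) (hline : ContainsNoLine (C : Set E)) :
    ∃ H : VField E M, ∀ (x : M) (v : TangentSpace 𝓘(ℝ, E) x), D H x v = v := by
  obtain ⟨H, hH⟩ := exists_mpullback_eq_radialField hp hf hline
  have hsm : CMDiff ∞ (T% H) := fun z => by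
    obtain ⟨x, rfl⟩ := hp.surjective z
    refine contMDiffAt_of_mpullback hp.isAffine.1 x ?_
    rw [hH]
    exact contMDiff_radialField hf.1.1 x
  refine ⟨⟨H, hsm⟩, fun z v => ?_⟩
  obtain ⟨x, rfl⟩ := hp.surjective z
  obtain ⟨w, rfl⟩ := (isInvertible_mfderiv (hp.isAffine.1 x)).bijective.surjective v
  have h := hp.isAffine.2 x H ((hsm _).mdifferentiableAt (by simp)) w
  rw [hH, connection_radialField hf.1] at h
  exact h.symm

end Radial

/-! ### A right unit makes parallel 2-chains exact -/

section Exact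

variable {A W : Type*} [AddCommGroup A] [Module ℝ A] [AddCommGroup W] [Module ℝ W]

theorem coboundary_one_apply (mul : A →ₗ[ℝ] A →ₗ[ℝ] A) (L : A →ₗ[ℝ] W →ₗ[ℝ] W)
    (θ : Chain 1 A W) (a : Fin 2 → A) :
    coboundary mul L 0 θ a = θ ![mul (a 0) (a 1)] - L (a 0) (θ ![a 1]) := by
  have h1 : Fin.removeNth 0 a = ![a 1] := by
    ext i; fin_cases i; rfl
  have h2 : Function.update ![a 1] 0 (mul (a 0) (a 1)) = ![mul (a 0) (a 1)] := by
    ext i; fin_cases i; rfl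
  rw [coboundary_apply, Fin.sum_univ_one, actRight_apply]
  simp [act_apply, h1, h2]

/-- Purely algebraic: in `(a₀ g)(H, a₁) = 0` the term `g(a₀ H, a₁)` is `g(a₀, a₁)` because `H` is a
right unit, and the two remaining terms form `δθ` for `θ = g(H, ·)`. -/
theorem eq_neg_coboundary_of_act_eq_zero (mul : A →ₗ[ℝ] A →ₗ[ℝ] A) (L : A →ₗ[ℝ] W →ₗ[ℝ] W)
    {g : Chain 2 A W} (hg : ∀ a, act mul L g a = 0) {H : A} (hH : ∀ a, mul a H = a) :
    g = -coboundary mul L 0 (g.curryLeft H) := by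
  ext a
  have h := congrArg (fun φ : Chain 2 A W => φ ![H, a 1]) (hg (a 0))
  have h1 : Function.update ![H, a 1] 0 (mul (a 0) H) = a := by
    rw [hH]; ext i; fin_cases i <;> rfl
  have h2 : Function.update ![H, a 1] 1 (mul (a 0) (a 1)) = ![H, mul (a 0) (a 1)] := by
    ext i; fin_cases i <;> rfl
  simp only [act_apply, Fin.sum_univ_two, Matrix.cons_val_zero, Matrix.cons_val_one,
    h1, h2, zero_apply] at h
  rw [neg_apply, coboundary_one_apply]
  simp only [MultilinearMap.curryLeft_apply]
  change g a = -(g ![H, mul (a 0) (a 1)] - L (a 0) (g ![H, a 1]))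
  rw [sub_eq_zero.1 h]
  abel

end Exact

end KV

theorem proposition9p1 {n : ℕ}
    {M : Type*} [TopologicalSpace M] [T2Space M] [SecondCountableTopology M]
    [ChartedSpace (EuclideanSpace ℝ (Fin n)) M]
    [IsManifold 𝓘(ℝ, EuclideanSpace ℝ (Fin n)) ∞ M]
    {M' : Type*} [TopologicalSpace M'] [ChartedSpace (EuclideanSpace ℝ (Fin n)) M']
    [IsManifold 𝓘(ℝ, EuclideanSpace ℝ (Fin n)) ∞ M']
    (D : KV.LocallyFlat (EuclideanSpace ℝ (Fin n)) M)
    (D' : KV.Connection (EuclideanSpace ℝ (Fin n)) M') (p : M' → M)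
    (hp : KV.IsUniversalCovering D' D.toCovariantDerivative p)
    (hyperbolic : KV.IsHyperbolicCover D')
    (cone : KV.IsIsoToConvexCone D') :
    (∃ H : KV.VField (EuclideanSpace ℝ (Fin n)) M, ∀ a, D.mul a H = a) ∧
    (∀ g : KV.Chain 2 (KV.VField (EuclideanSpace ℝ (Fin n)) M)
        (KV.SmoothFun (EuclideanSpace ℝ (Fin n)) M),
      D.IsParallel g →
        D.IsExact g ∧
        ∀ H : KV.VField (EuclideanSpace ℝ (Fin n)) M, (∀ a, D.mul a H = a) →
          ∃ θ : KV.Chain 1 (KV.VField (EuclideanSpace ℝ (Fin n)) M)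
            (KV.SmoothFun (EuclideanSpace ℝ (Fin n)) M),
            (∀ a, θ ![a] = g ![H, a]) ∧ g = - D.δ θ) := by
  have := hp.simplyConnected
  obtain ⟨Ω, f₀, -, hΩ, hf₀⟩ := hyperbolic
  obtain ⟨C, f, hf⟩ := cone
  have hline := hf.containsNoLine hf₀ C.convex hΩ
  obtain ⟨H₀, hH₀⟩ := KV.exists_radial_vectorField hp hf hline
  have hH₀' : ∀ a, D.mul a H₀ = a := fun a => by
    ext x
    exact hH₀ x (a x)
  refine ⟨⟨H₀, hH₀'⟩, fun g hg => ⟨⟨-g.curryLeft H₀, ?_⟩, fun H hH => ⟨g.curryLeft H, ?_, ?_⟩⟩⟩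
  · refine Eq.trans ?_ (KV.eq_neg_coboundary_of_act_eq_zero D.mul KV.derivAct hg hH₀').symm
    ext1 a
    -- The primitive is `-θ`; the identity `δ(-θ) = -δθ` is read off the explicit formula in degree
    -- one.
    rw [neg_apply, KV.LocallyFlat.δ, KV.coboundary_one_apply,
      KV.coboundary_one_apply]
    simp only [neg_apply, map_neg]
    abel
  · exact fun a => rfl
  · exact KV.eq_neg_coboundary_of_act_eq_zero D.mul KV.derivAct hg hH
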